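/- Fix real constants $\mu,\kappa,\alpha,\beta,\gamma,\lambda,\nu,\tau$ with $\mu>0$, $\kappa>0$, $\tilde\alpha:=\alpha+\tfrac{4\beta}{3}>0$, $\tilde\gamma:=\beta+\gamma>0$, $\tau>0$ and $\lambda>\nu>0$. Put $d=\frac{\tau}{2\kappa}$, $J=\mathrm{diag}(\lambda,\lambda,\nu)$, $s=-\frac{d}{\sqrt{\lambda-\nu}}$. For $k\in\mathbb R^3$ let $P_\parallel(k)$ and $P_\perp(k)$ be the orthogonal projections onto the span of $k$ and onto its orthogonal complement (so $P_\parallel(0)=0$, $P_\perp(0)=I$), let $k\times$ denote the matrix of $z\mapsto k\times z$, and let $T(k)=\frac{ik\times}{|k|}$ if $k\ne0$, $T(0)=0$. For $a,b\in\{2,3\}$ let $R_{ab}$ be the $a\times b$ matrix with entry $-1$ at position $(1,2)$, entry $1$ at position $(2,1)$ and all other entries $0$. Define the complex $8\times8$ matrices (blocks of sizes $3,3,2$) $$\hat{\mathcal B}_k=\begin{pmatrix}-(\mu+\frac\kappa2)|k|^2P_\perp(k)& i\kappa k\times&0\\ J^{-1}(i\kappa k\times)P_\perp(k)&-2\kappa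 J^{-1}-\tilde\alpha|k|^2J^{-1}P_\parallel(k)-\tilde\gamma|k|^2J^{-1}P_\perp(k)-(1-\frac\nu\lambda)d\,R_{33}&-\frac1\lambda d^2R_{32}\\0&(\lambda-\nu)R_{23}&d\,R_{22}\end{pmatrix},$$ $$Q_k=T(k)\oplus J^{1/2}\oplus sR_{22},\qquad \bar Q_k=T(k)\oplus J^{-1/2}\oplus(-s^{-1})R_{22},\qquad M_k=Q_k\hat{\mathcal B}_k\bar Q_k .$$ Let $|\cdot|$ be the operator norm on matrices induced by the Euclidean norm. Then the maximum $$\eta_*=\max\{\operatorname{Re}w:\ k\in\mathbb Z^3,\ w\text{ an eigenvalue of }M_k\}$$ exists and is strictly positive, and: (1) there is $C_S>0$ such that $|e^{tM_k}|\le C_S(1+t^8)e^{\eta_*t}$ for every $k\in\mathbb Z^3$ and every $t>0$; (2) consequently, for every $\varepsilon>0$ there is $C_S(\varepsilon)>0$ such that $|e^{t\hat{\mathcal B}_k}|\le C_S(\varepsilon)e^{(\eta_*+\varepsilon)t}$ for every $k\in\mathbb Z^3$ and every $t>0$. -/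

import Mathlib

open scoped Matrix Matrix.Norms.L2Operator

noncomputable section

namespace Micropolar

/-- Physical constants of an anisotropic micropolar fluid: viscosities `μ, κ, α, β, γ`,
eigenvalues `lam, lam, nu` of the microinertia, magnitude `τ` of the microtorque. -/
structure Params where
  (μ κ α β γ lam nu τ : ℝ)

/-- Wavenumbers `k ∈ ℝ³`, with the Euclidean norm. -/
abbrev Wave := EuclideanSpace ℝ (Fin 3)

/-- The lattice `ℤ³` inside `ℝ³`. -/
def latticeVec (k : Fin 3 → ℤ) : Wave := WithLp.toLp 2 (fun i => (k i : ℝ))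

/-- The eight components `(u, ω, a) ∈ ℂ³ × ℂ³ × ℂ²`. -/
abbrev Idx := Fin 3 ⊕ (Fin 3 ⊕ Fin 2)

/-- A `3 × 3` block matrix with blocks of sizes `3, 3, 2`. -/
def blocks
    (A₁₁ : Matrix (Fin 3) (Fin 3) ℂ) (A₁₂ : Matrix (Fin 3) (Fin 3) ℂ)
    (A₁₃ : Matrix (Fin 3) (Fin 2) ℂ)
    (A₂₁ : Matrix (Fin 3) (Fin 3) ℂ) (A₂₂ : Matrix (Fin 3) (Fin 3) ℂ)
    (A₂₃ : Matrix (Fin 3) (Fin 2) ℂ)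
    (A₃₁ : Matrix (Fin 2) (Fin 3) ℂ) (A₃₂ : Matrix (Fin 2) (Fin 3) ℂ)
    (A₃₃ : Matrix (Fin 2) (Fin 2) ℂ) : Matrix Idx Idx ℂ :=
  Matrix.fromBlocks A₁₁ (Matrix.fromCols A₁₂ A₁₃) (Matrix.fromRows A₂₁ A₃₁)
    (Matrix.fromBlocks A₂₂ A₂₃ A₃₂ A₃₃)

/-- A real matrix regarded as a complex one. -/
def toC {m n : Type} (A : Matrix m n ℝ) : Matrix m n ℂ := A.map Complex.ofReal

/-- The matrix of `z ↦ k × z`. -/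
def cross (k : Wave) : Matrix (Fin 3) (Fin 3) ℝ :=
  !![0, -k 2, k 1;
     k 2, 0, -k 0;
     -k 1, k 0, 0]

/-- Orthogonal projection onto the span of `k`: `k ⊗ k / |k|²` for `k ≠ 0`, and `0` for `k = 0`
(where the quotients below are `0 / 0 = 0`). -/
def Ppar (k : Wave) : Matrix (Fin 3) (Fin 3) ℝ :=
  Matrix.of fun i j => k i * k j / ‖k‖ ^ 2

/-- Orthogonal projection onto the orthogonal complement of `k`; the identity for `k = 0`. -/
def Pperp (k : Wave) : Matrix (Fin 3) (Fin 3) ℝ := 1 - Ppar k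

def R22 : Matrix (Fin 2) (Fin 2) ℝ := !![0, -1; 1, 0]
def R23 : Matrix (Fin 2) (Fin 3) ℝ := !![0, -1, 0; 1, 0, 0]
def R32 : Matrix (Fin 3) (Fin 2) ℝ := !![0, -1; 1, 0; 0, 0]
def R33 : Matrix (Fin 3) (Fin 3) ℝ := !![0, -1, 0; 1, 0, 0; 0, 0, 0]

namespace Params

variable (p : Params)

def αt : ℝ := p.α + 4 * p.β / 3
def γt : ℝ := p.β + p.γ

/-- The equilibrium angular speed `τ / (2 κ)`. -/
def d : ℝ := p.τ / (2 * p.κ)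

/-- The inverse of `J_eq = diag (lam, lam, nu)`. -/
def JInv : Matrix (Fin 3) (Fin 3) ℝ := Matrix.diagonal ![p.lam⁻¹, p.lam⁻¹, p.nu⁻¹]

/-- The square root of `J_eq`. -/
def JSqrt : Matrix (Fin 3) (Fin 3) ℝ :=
  Matrix.diagonal ![√p.lam, √p.lam, √p.nu]

/-- The inverse square root of `J_eq`. -/
def JInvSqrt : Matrix (Fin 3) (Fin 3) ℝ :=
  Matrix.diagonal ![(√p.lam)⁻¹, (√p.lam)⁻¹, (√p.nu)⁻¹]

/-- The symbol `B̂_k` of the (Leray-projected) linearized operator acting on `(u, ω, a)`. -/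
def symbolB (k : Wave) : Matrix Idx Idx ℂ :=
  blocks
    (toC (-((p.μ + p.κ / 2) * ‖k‖ ^ 2) • Pperp k))
    ((Complex.I * (p.κ : ℂ)) • toC (cross k))
    0
    (toC p.JInv * ((Complex.I * (p.κ : ℂ)) • toC (cross k)) * toC (Pperp k))
    (toC (-(2 * p.κ) • p.JInv
        - (p.αt * ‖k‖ ^ 2) • (p.JInv * Ppar k)
        - (p.γt * ‖k‖ ^ 2) • (p.JInv * Pperp k)
        - ((1 - p.nu / p.lam) * p.d) • R33))
    (toC (-(1 / p.lam * p.d ^ 2) • R32))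
    0
    (toC ((p.lam - p.nu) • R23))
    (toC (p.d • R22))

/-- `T(k) = i k × / |k|` for `k ≠ 0` and `T(0) = 0` (since `cross 0 = 0`). -/
def T (k : Wave) : Matrix (Fin 3) (Fin 3) ℂ :=
  (Complex.I / (‖k‖ : ℂ)) • toC (cross k)

def s : ℝ := -1 / √(p.lam - p.nu) * p.d

/-- `Q_k = T(k) ⊕ J_eq^{1/2} ⊕ s R`. -/
def Q (k : Wave) : Matrix Idx Idx ℂ :=
  blocks (T k) 0 0 0 (toC p.JSqrt) 0 0 0 (toC (p.s • R22))

/-- `Q̄_k = T(k) ⊕ J_eq^{-1/2} ⊕ (-s⁻¹) R`. -/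
def Qbar (k : Wave) : Matrix Idx Idx ℂ :=
  blocks (T k) 0 0 0 (toC p.JInvSqrt) 0 0 0 (toC ((-p.s⁻¹) • R22))

/-- `M_k = Q_k B̂_k Q̄_k` (a matrix whose entries are in fact real). -/
def M (k : Wave) : Matrix Idx Idx ℂ := p.Q k * p.symbolB k * p.Qbar k

/-- The set of real parts of the eigenvalues of all `M_k`, `k ∈ ℤ³`. -/
def growthRates : Set ℝ :=
  {r | ∃ (k : Fin 3 → ℤ) (w : ℂ),
    Module.End.HasEigenvalue (Matrix.toLin' (p.M (latticeVec k))) w ∧ r = w.re}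

end Params

end Micropolar

end

/-! Conjugation by `Q k` makes the symbol real: `M k` is a symmetric matrix plus an antisymmetric
part bounded in `k`, which does not enter the real quadratic form (`M_eq`,
`dotProduct_realM_mulVec`). In that form, viscosity and rotational friction absorb the coupling of
`u` and `ω`. What can cause growth is the coupling of `ω` and `a`, of fixed size; the dissipation `m
* ‖k‖ ^ 2` in `ω` dominates it up to `η * |a| ^ 2`, for any prescribed `η > 0`, as soon as `‖k‖` is
large (`energy_le`).

At `k = 0` the matrix has an eigenvalue `w₀` with positive real part
(`exists_hasEigenvalue_M_zero`). With `η = w₀.re` in the energy estimate, all but finitely many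
lattice points have numerical range in `Re ≤ w₀.re`. Hence the supremum of the growth rates is
decided by finitely many finite spectra and is attained, and the semigroup at the other points is
bounded by `exp (w₀.re * t)` with constant `1`. Each of the finitely many remaining matrices obeys
the Jordan-type bound with a polynomial factor (`exists_norm_exp_smul_le`).

The symbol itself is singularly intertwined with `M k`: `Qbar k * Q k` is a projection on whose
complement the symbol vanishes, so its exponential is recovered from that of `M k` with factors
bounded in `k` (`exp_smul_symbolB`). An exponential `exp (ε * t)` absorbs the polynomial. -/

section Operators

/-! ### Growth of operator exponentials: spectral bound and numerical-range bound. -/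

variable {E : Type*} [NormedAddCommGroup E]

/-- The scalar `w` and `A - w` commute, and on a generalized eigenvector the exponential series of
`A - w` terminates. -/
theorem exp_smul_apply_of_pow_apply_eq_zero [NormedSpace ℂ E] [CompleteSpace E]
    (A : E →L[ℂ] E) (w z : ℂ) (n : ℕ) (v : E) (h : ((A - w • (1 : E →L[ℂ] E)) ^ n) v = 0) :
    NormedSpace.exp (z • A) v = Complex.exp (z * w) •
      ∑ j ∈ Finset.range n, ((j.factorial : ℂ)⁻¹ * z ^ j) • ((A - w • (1 : E →L[ℂ] E)) ^ j) v := by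
  let _ : NormedAlgebra ℚ (E →L[ℂ] E) := NormedAlgebra.restrictScalars ℚ ℂ _
  set N := A - w • (1 : E →L[ℂ] E) with hN
  have hz : z • A = algebraMap ℂ (E →L[ℂ] E) (z * w) + z • N := by
    rw [hN, Algebra.algebraMap_eq_smul_one, smul_sub, smul_smul]; abel
  have hcomm : Commute (algebraMap ℂ (E →L[ℂ] E) (z * w)) (z • N) := Algebra.commutes _ _
  have hvanish : ∀ j, n ≤ j → (N ^ j) v = 0 := by
    intro j hj
    obtain ⟨i, rfl⟩ := Nat.exists_eq_add_of_le' hj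
    rw [pow_add, mul_apply_eq_comp, h, map_zero]
  have hsum : NormedSpace.exp (z • N) v =
      ∑ j ∈ Finset.range n, ((j.factorial : ℂ)⁻¹ * z ^ j) • (N ^ j) v := by
    have h1 := (NormedSpace.exp_series_hasSum_exp' (𝕂 := ℂ) (z • N)).mapL
      (ContinuousLinearMap.apply ℂ E v)
    refine h1.unique ?_
    have h2 : ∀ j, (ContinuousLinearMap.apply ℂ E v) (((j.factorial : ℂ)⁻¹) • (z • N) ^ j) =
        ((j.factorial : ℂ)⁻¹ * z ^ j) • (N ^ j) v := by
      intro j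
      simp [smul_pow, smul_smul]
    simp_rw [h2]
    refine hasSum_sum_of_ne_finset_zero fun j hj => ?_
    rw [hvanish j (by simpa using hj), smul_zero]
  rw [hz, NormedSpace.exp_add_of_commute hcomm, ← NormedSpace.algebraMap_exp_comm,
    mul_apply_eq_comp, hsum, ← Complex.exp_eq_exp_ℂ, Algebra.algebraMap_eq_smul_one]
  rfl

theorem exists_norm_exp_smul_le [NormedSpace ℂ E] [FiniteDimensional ℂ E]
    (A : E →L[ℂ] E) (η : ℝ)
    (hη : ∀ w : ℂ, Module.End.HasEigenvalue (A : E →ₗ[ℂ] E) w → w.re ≤ η) :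
    ∃ C : ℝ, 0 < C ∧ ∀ t : ℝ, 0 < t → ‖NormedSpace.exp ((t : ℂ) • A)‖
      ≤ C * (1 + t ^ Module.finrank ℂ E) * Real.exp (η * t) := by
  have : CompleteSpace E := FiniteDimensional.complete ℂ E
  set n := Module.finrank ℂ E with hn
  -- The vectors whose orbit obeys the bound, each with its own constant, form a subspace. It
  -- contains all generalized eigenspaces, hence is everything; a finite basis then makes the
  -- constant uniform.
  let S : Submodule ℂ E :=
    { carrier := {v | ∃ C : ℝ, 0 ≤ C ∧ ∀ t : ℝ, 0 < t →
        ‖NormedSpace.exp ((t : ℂ) • A) v‖ ≤ C * ((1 + t ^ n) * Real.exp (η * t))}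
      zero_mem' := ⟨0, le_rfl, fun t _ => by simp⟩
      add_mem' := by
        rintro v₁ v₂ ⟨C₁, hC₁, h₁⟩ ⟨C₂, hC₂, h₂⟩
        refine ⟨C₁ + C₂, by positivity, fun t ht => ?_⟩
        rw [map_add, add_mul]
        exact (norm_add_le _ _).trans (add_le_add (h₁ t ht) (h₂ t ht))
      smul_mem' := by
        rintro c v ⟨C, hC, h⟩
        refine ⟨‖c‖ * C, by positivity, fun t ht => ?_⟩
        rw [map_smul, norm_smul, mul_assoc]
        exact mul_le_mul_of_nonneg_left (h t ht) (norm_nonneg c) }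
  have hS : ∀ v, v ∈ S := by
    have htop : (⊤ : Submodule ℂ E) ≤ S := by
      rw [← Module.End.iSup_maxGenEigenspace_eq_top (A : E →ₗ[ℂ] E)]
      refine iSup_le fun w v hv => ?_
      by_cases hv0 : v = 0
      · rw [hv0]; exact S.zero_mem
      have hw : Module.End.HasEigenvalue (A : E →ₗ[ℂ] E) w := by
        obtain ⟨l, hl⟩ := Module.End.mem_genEigenspace_top.1 hv
        refine Module.End.hasEigenvalue_of_hasGenEigenvalue (k := l) fun hbot => hv0 ?_
        have : v ∈ Module.End.genEigenspace (A : E →ₗ[ℂ] E) w l := Module.End.mem_genEigenspace_nat.2 hl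
        rwa [hbot, Submodule.mem_bot] at this
      rw [Module.End.maxGenEigenspace_eq_genEigenspace_finrank,
        Module.End.mem_genEigenspace_nat, LinearMap.mem_ker] at hv
      have hv' : ((A - w • (1 : E →L[ℂ] E)) ^ n) v = 0 := by
        rw [← hv, ← ContinuousLinearMap.coe_coe, ContinuousLinearMap.toLinearMap_pow]
        rfl
      refine ⟨∑ j ∈ Finset.range n, ‖((A - w • (1 : E →L[ℂ] E)) ^ j) v‖,
        Finset.sum_nonneg fun _ _ => norm_nonneg _, fun t ht => ?_⟩
      rw [exp_smul_apply_of_pow_apply_eq_zero A w t n v hv', norm_smul, Complex.norm_exp]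
      have hexp : Real.exp (((t : ℂ) * w).re) ≤ Real.exp (η * t) := by
        apply Real.exp_le_exp.2
        rw [Complex.re_ofReal_mul, mul_comm]
        exact mul_le_mul_of_nonneg_right (hη w hw) ht.le
      have hsum : ‖∑ j ∈ Finset.range n, ((j.factorial : ℂ)⁻¹ * (t : ℂ) ^ j) •
            ((A - w • (1 : E →L[ℂ] E)) ^ j) v‖ ≤
          (∑ j ∈ Finset.range n, ‖((A - w • (1 : E →L[ℂ] E)) ^ j) v‖) * (1 + t ^ n) := by
        rw [Finset.sum_mul]
        refine norm_sum_le_of_le _ fun j hj => ?_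
        rw [norm_smul, mul_comm]
        refine mul_le_mul_of_nonneg_left ?_ (norm_nonneg _)
        rw [norm_mul, norm_inv, norm_pow, Complex.norm_natCast, Complex.norm_real,
          Real.norm_of_nonneg ht.le]
        have h1 : ((j.factorial : ℝ))⁻¹ ≤ 1 :=
          inv_le_one_of_one_le₀ (by exact_mod_cast j.factorial_pos)
        have h2 : t ^ j ≤ 1 + t ^ n := by
          rcases le_total t 1 with h | h
          · have := pow_le_one₀ (n := j) ht.le h
            have := pow_pos ht n
            linarith
          · have := pow_le_pow_right₀ h (Finset.mem_range.1 hj).le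
            linarith
        calc ((j.factorial : ℝ))⁻¹ * t ^ j ≤ 1 * t ^ j :=
              mul_le_mul_of_nonneg_right h1 (by positivity)
          _ ≤ _ := by rw [one_mul]; exact h2
      calc _ ≤ Real.exp (η * t) * ((∑ j ∈ Finset.range n,
              ‖((A - w • (1 : E →L[ℂ] E)) ^ j) v‖) * (1 + t ^ n)) :=
            mul_le_mul hexp hsum (norm_nonneg _) (Real.exp_pos _).le
        _ = _ := by ring
    exact fun v => htop Submodule.mem_top
  choose C hC0 hC using hS
  let b := Module.finBasis ℂ E
  obtain ⟨K, hK, hKb⟩ := b.exists_opNorm_le (F := E)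
  refine ⟨K * (1 + ∑ i, C (b i)),
    mul_pos hK (add_pos_of_pos_of_nonneg one_pos (Finset.sum_nonneg fun i _ => hC0 _)),
    fun t ht => ?_⟩
  rw [mul_assoc, mul_assoc]
  have hpos : 0 ≤ (1 + t ^ n) * Real.exp (η * t) := by positivity
  have hCsum : 0 ≤ ∑ i, C (b i) := Finset.sum_nonneg fun i _ => hC0 _
  refine hKb (by positivity) fun i => (hC (b i) t ht).trans ?_
  refine mul_le_mul_of_nonneg_right ?_ hpos
  have := Finset.single_le_sum (f := fun i => C (b i)) (fun i _ => hC0 _) (Finset.mem_univ i)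
  linarith

/-- Along an orbit `x`, the quantity `‖x r‖ ^ 2 * exp (-2 * η * r)` has nonpositive derivative. No
constant is lost, which gives uniformity over infinitely many wavenumbers. -/
theorem norm_exp_smul_le_of_re_inner_le [InnerProductSpace ℂ E] [CompleteSpace E]
    (A : E →L[ℂ] E) (η : ℝ) (hA : ∀ v, (inner ℂ v (A v)).re ≤ η * ‖v‖ ^ 2)
    (t : ℝ) (ht : 0 ≤ t) : ‖NormedSpace.exp ((t : ℂ) • A)‖ ≤ Real.exp (η * t) := by
  refine ContinuousLinearMap.opNorm_le_bound _ (Real.exp_pos _).le fun v => ?_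
  let x : ℝ → E := fun r => NormedSpace.exp (r • A) v
  have hx : ∀ r, HasDerivAt x (A (x r)) r := fun r =>
    ((ContinuousLinearMap.apply ℂ E v).restrictScalars ℝ).hasFDerivAt.comp_hasDerivAt r
      (hasDerivAt_exp_smul_const' (𝕂 := ℝ) A r)
  -- The real inner product is by definition the real part of the complex one, so `hA` applies to it
  -- as it stands.
  let _ : InnerProductSpace ℝ E := InnerProductSpace.rclikeToReal ℂ E
  let g : ℝ → ℝ := fun r => ‖x r‖ ^ 2 * Real.exp (-(2 * η) * r)
  have hg : ∀ r, HasDerivAt g ((2 * inner ℝ (x r) (A (x r))) * Real.exp (-(2 * η) * r) +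
      ‖x r‖ ^ 2 * (Real.exp (-(2 * η) * r) * (-(2 * η)))) r := fun r =>
    (hx r).norm_sq.mul ((hasDerivAt_const_mul (-(2 * η))).exp)
  have hanti : Antitone g := antitone_of_hasDerivAt_nonpos hg fun r => by
    have h1 : inner ℝ (x r) (A (x r)) ≤ η * ‖x r‖ ^ 2 := hA (x r)
    have h2 := Real.exp_pos (-(2 * η) * r)
    have h3 : (η * ‖x r‖ ^ 2 - inner ℝ (x r) (A (x r))) * Real.exp (-(2 * η) * r) ≥ 0 :=
      mul_nonneg (sub_nonneg.2 h1) h2.le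
    simp only [Pi.zero_apply]
    linarith
  have h0 := hanti ht
  have hx0 : x 0 = v := by simp [x]
  simp only [g, hx0, mul_zero, Real.exp_zero, mul_one] at h0
  have hxt : NormedSpace.exp ((t : ℂ) • A) v = x t := rfl
  rw [hxt]
  refine le_of_sq_le_sq ?_ (by positivity)
  have hexp : Real.exp (-(2 * η) * t) * Real.exp (η * t) ^ 2 = 1 := by
    rw [← Real.exp_nat_mul, ← Real.exp_add]
    simp only [Nat.cast_ofNat, Real.exp_eq_one_iff]
    ring
  calc ‖x t‖ ^ 2 = ‖x t‖ ^ 2 * Real.exp (-(2 * η) * t) * Real.exp (η * t) ^ 2 := by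
        rw [mul_assoc, hexp, mul_one]
    _ ≤ ‖v‖ ^ 2 * Real.exp (η * t) ^ 2 := mul_le_mul_of_nonneg_right h0 (by positivity)
    _ = _ := by ring

end Operators

section Matrices

/-! ### Transfer of the operator bounds to complex matrices. -/

variable {ι : Type*} [Fintype ι]

theorem Matrix.re_star_dotProduct_map_ofReal_mulVec (A : Matrix ι ι ℝ) (v : ι → ℂ) :
    (star v ⬝ᵥ A.map Complex.ofReal *ᵥ v).re =
      (fun i => (v i).re) ⬝ᵥ A *ᵥ (fun i => (v i).re) +
      (fun i => (v i).im) ⬝ᵥ A *ᵥ (fun i => (v i).im) := by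
  simp only [dotProduct, mulVec, Complex.re_sum, Finset.mul_sum, ← Finset.sum_add_distrib]
  refine Finset.sum_congr rfl fun i _ => Finset.sum_congr rfl fun j _ => ?_
  simp only [Pi.star_apply, RCLike.star_def, Matrix.map_apply, Complex.mul_re, Complex.mul_im,
    Complex.conj_re, Complex.conj_im, Complex.ofReal_re, Complex.ofReal_im]
  ring

theorem Matrix.re_star_dotProduct_le_of_real (A : Matrix ι ι ℝ) (η : ℝ)
    (hA : ∀ x : ι → ℝ, x ⬝ᵥ A *ᵥ x ≤ η * ∑ i, x i ^ 2) (v : ι → ℂ) :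
    (star v ⬝ᵥ A.map Complex.ofReal *ᵥ v).re ≤ η * ∑ i, ‖v i‖ ^ 2 := by
  rw [Matrix.re_star_dotProduct_map_ofReal_mulVec]
  refine (add_le_add (hA _) (hA _)).trans_eq ?_
  rw [← mul_add, ← Finset.sum_add_distrib]
  congr 1
  refine Finset.sum_congr rfl fun i _ => ?_
  rw [← Complex.normSq_eq_norm_sq, Complex.normSq_apply]
  ring

variable [DecidableEq ι]

theorem toEuclideanCLM_exp (A : Matrix ι ι ℂ) :
    Matrix.toEuclideanCLM (n := ι) (𝕜 := ℂ) (NormedSpace.exp A) =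
      NormedSpace.exp (Matrix.toEuclideanCLM (n := ι) (𝕜 := ℂ) A) := by
  let _ : NormedAlgebra ℚ (Matrix ι ι ℂ) := NormedAlgebra.restrictScalars ℚ ℂ _
  let _ : NormedAlgebra ℚ (EuclideanSpace ℂ ι →L[ℂ] EuclideanSpace ℂ ι) :=
    NormedAlgebra.restrictScalars ℚ ℂ _
  exact NormedSpace.map_exp (Matrix.toEuclideanCLM (n := ι) (𝕜 := ℂ))
    (AddMonoidHomClass.continuous_of_bound _ 1 fun x => by
      rw [one_mul, Matrix.cstar_norm_def]) A

theorem norm_exp_smul_eq (A : Matrix ι ι ℂ) (z : ℂ) :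
    ‖NormedSpace.exp (z • A)‖ =
      ‖NormedSpace.exp (z • Matrix.toEuclideanCLM (n := ι) (𝕜 := ℂ) A)‖ := by
  rw [Matrix.cstar_norm_def, toEuclideanCLM_exp, map_smul]

theorem hasEigenvalue_toLin'_of_toEuclideanCLM (A : Matrix ι ι ℂ) (w : ℂ)
    (h : Module.End.HasEigenvalue ((Matrix.toEuclideanCLM (n := ι) (𝕜 := ℂ) A :
      EuclideanSpace ℂ ι →L[ℂ] EuclideanSpace ℂ ι) :
      EuclideanSpace ℂ ι →ₗ[ℂ] EuclideanSpace ℂ ι) w) :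
    Module.End.HasEigenvalue (Matrix.toLin' A) w := by
  obtain ⟨v, hv⟩ := h.exists_hasEigenvector
  refine Module.End.hasEigenvalue_of_hasEigenvector (x := WithLp.ofLp v)
    ⟨Module.End.mem_eigenspace_iff.2 ?_, fun h0 => hv.2 ((WithLp.ofLp_eq_zero 2).1 h0)⟩
  exact congrArg WithLp.ofLp hv.apply_eq_smul

theorem Matrix.exists_norm_exp_smul_le (A : Matrix ι ι ℂ) (η : ℝ)
    (hη : ∀ w : ℂ, Module.End.HasEigenvalue (Matrix.toLin' A) w → w.re ≤ η) :
    ∃ C : ℝ, 0 < C ∧ ∀ t : ℝ, 0 < t → ‖NormedSpace.exp ((t : ℂ) • A)‖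
      ≤ C * (1 + t ^ Fintype.card ι) * Real.exp (η * t) := by
  simp_rw [norm_exp_smul_eq]
  rw [← finrank_euclideanSpace (𝕜 := ℂ) (ι := ι)]
  exact _root_.exists_norm_exp_smul_le _ η fun w hw =>
    hη w (hasEigenvalue_toLin'_of_toEuclideanCLM A w hw)

theorem Matrix.norm_exp_smul_le (A : Matrix ι ι ℂ) (η : ℝ)
    (hA : ∀ v : ι → ℂ, (star v ⬝ᵥ A *ᵥ v).re ≤ η * ∑ i, ‖v i‖ ^ 2) (t : ℝ) (ht : 0 ≤ t) :
    ‖NormedSpace.exp ((t : ℂ) • A)‖ ≤ Real.exp (η * t) := by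
  rw [norm_exp_smul_eq]
  refine norm_exp_smul_le_of_re_inner_le _ η (fun v => ?_) t ht
  rw [EuclideanSpace.norm_sq_eq]
  refine le_of_eq_of_le ?_ (hA v)
  rw [EuclideanSpace.inner_eq_star_dotProduct, Matrix.ofLp_toEuclideanCLM, dotProduct_comm]

theorem Matrix.re_le_of_hasEigenvalue (A : Matrix ι ι ℂ) (η : ℝ)
    (hA : ∀ v : ι → ℂ, (star v ⬝ᵥ A *ᵥ v).re ≤ η * ∑ i, ‖v i‖ ^ 2) (w : ℂ)
    (hw : Module.End.HasEigenvalue (Matrix.toLin' A) w) : w.re ≤ η := by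
  obtain ⟨v, hv⟩ := hw.exists_hasEigenvector
  have h1 : A *ᵥ v = w • v := hv.apply_eq_smul
  have h2 : star v ⬝ᵥ v = ((∑ i, ‖v i‖ ^ 2 : ℝ) : ℂ) := by
    rw [dotProduct, Complex.ofReal_sum]
    refine Finset.sum_congr rfl fun i _ => ?_
    rw [Pi.star_apply, Complex.ofReal_pow, RCLike.star_def, Complex.conj_mul']
  have h3 := hA v
  rw [h1, dotProduct_smul, h2, smul_eq_mul, Complex.re_mul_ofReal] at h3
  refine le_of_mul_le_mul_right h3 ?_
  obtain ⟨i, hi⟩ := Function.ne_iff.1 hv.2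
  exact Finset.sum_pos' (fun i _ => by positivity)
    ⟨i, Finset.mem_univ i, pow_pos (norm_pos_iff.2 hi) 2⟩

theorem Matrix.exists_norm_le_of_norm_apply_le (ι : Type*) [Fintype ι] [DecidableEq ι] (c : ℝ) :
    ∃ C : ℝ, 0 ≤ C ∧ ∀ A : Matrix ι ι ℂ, (∀ i j, ‖A i j‖ ≤ c) → ‖A‖ ≤ C := by
  refine ⟨∑ i : ι, ∑ j : ι, |c| * ‖Matrix.single i j (1 : ℂ)‖, by positivity, fun A hA => ?_⟩
  rw [Matrix.matrix_eq_sum_single A]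
  refine norm_sum_le_of_le _ fun i _ => norm_sum_le_of_le _ fun j _ => ?_
  have : Matrix.single i j (A i j) = A i j • Matrix.single i j (1 : ℂ) := by
    rw [Matrix.smul_single, smul_eq_mul, mul_one]
  rw [this, norm_smul]
  exact mul_le_mul_of_nonneg_right ((hA i j).trans (le_abs_self c)) (norm_nonneg _)

end Matrices

noncomputable section

namespace Micropolar

open Params

/-! ### Block products and the algebra of `T`, `cross` and the projections. -/

theorem blocks_diagonal_mul_blocks_mul_diagonal
    (L₁ L₂ R₁ R₂ : Matrix (Fin 3) (Fin 3) ℂ) (L₃ R₃ : Matrix (Fin 2) (Fin 2) ℂ)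
    (A₁₁ A₁₂ A₂₁ A₂₂ : Matrix (Fin 3) (Fin 3) ℂ) (A₁₃ A₂₃ : Matrix (Fin 3) (Fin 2) ℂ)
    (A₃₁ A₃₂ : Matrix (Fin 2) (Fin 3) ℂ) (A₃₃ : Matrix (Fin 2) (Fin 2) ℂ) :
    blocks L₁ 0 0 0 L₂ 0 0 0 L₃ * blocks A₁₁ A₁₂ A₁₃ A₂₁ A₂₂ A₂₃ A₃₁ A₃₂ A₃₃ *
        blocks R₁ 0 0 0 R₂ 0 0 0 R₃ =
      blocks (L₁ * A₁₁ * R₁) (L₁ * A₁₂ * R₂) (L₁ * A₁₃ * R₃)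
        (L₂ * A₂₁ * R₁) (L₂ * A₂₂ * R₂) (L₂ * A₂₃ * R₃)
        (L₃ * A₃₁ * R₁) (L₃ * A₃₂ * R₂) (L₃ * A₃₃ * R₃) := by
  simp [blocks, Matrix.fromBlocks_multiply, Matrix.mul_fromCols,
    Matrix.fromCols_mul_fromBlocks, Matrix.fromBlocks_mul_fromRows, Matrix.fromRows_mul]

theorem blocks_one : blocks 1 0 0 0 1 0 0 0 1 = 1 := by
  simp [blocks]

theorem toC_mul {l m n : Type} [Fintype m] (A : Matrix l m ℝ) (B : Matrix m n ℝ) :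
    toC (A * B) = toC A * toC B := Matrix.map_mul (f := Complex.ofRealHom)

theorem toC_smul {m n : Type} (c : ℝ) (A : Matrix m n ℝ) : toC (c • A) = (c : ℂ) • toC A := by
  ext; simp [toC]

theorem toC_one {m : Type} [DecidableEq m] : toC (1 : Matrix m m ℝ) = 1 := by
  simp [toC]

theorem norm_sq_wave (k : Wave) : ‖k‖ ^ 2 = k 0 ^ 2 + k 1 ^ 2 + k 2 ^ 2 := by
  simp [EuclideanSpace.norm_sq_eq, Fin.sum_univ_three]

theorem cross_mul_cross (k : Wave) : cross k * cross k = -‖k‖ ^ 2 • Pperp k := by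
  rcases eq_or_ne k 0 with rfl | hk
  · ext i j; fin_cases i <;> fin_cases j <;> simp [cross, Matrix.mul_apply, Fin.sum_univ_three]
  have h := norm_sq_wave k
  have hk' : ‖k‖ ^ 2 ≠ 0 := by positivity
  ext i j
  fin_cases i <;> fin_cases j <;>
    simp [cross, Pperp, Ppar, Matrix.mul_apply, Fin.sum_univ_three, mul_sub,
      mul_div_cancel₀ _ hk'] <;> linarith [h]

theorem cross_mul_Ppar (k : Wave) : cross k * Ppar k = 0 := by
  ext i j
  fin_cases i <;> simp [cross, Ppar, Matrix.mul_apply, Fin.sum_univ_three] <;> ring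

theorem Ppar_mul_cross (k : Wave) : Ppar k * cross k = 0 := by
  ext i j
  fin_cases j <;> simp [cross, Ppar, Matrix.mul_apply, Fin.sum_univ_three] <;> ring

theorem cross_mul_Pperp (k : Wave) : cross k * Pperp k = cross k := by
  rw [Pperp, mul_sub, cross_mul_Ppar, mul_one, sub_zero]

theorem Pperp_mul_cross (k : Wave) : Pperp k * cross k = cross k := by
  rw [Pperp, sub_mul, Ppar_mul_cross, one_mul, sub_zero]

theorem cross_zero : cross 0 = 0 := by
  ext i j; fin_cases i <;> fin_cases j <;> simp [cross]

theorem T_mul_cross (k : Wave) : T k * toC (cross k) = (-Complex.I * ‖k‖) • toC (Pperp k) := by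
  rcases eq_or_ne k 0 with rfl | hk
  · simp [cross_zero, toC]
  have hk' : (‖k‖ : ℂ) ≠ 0 := by exact_mod_cast (norm_pos_iff.2 hk).ne'
  rw [T, smul_mul_assoc, ← toC_mul, cross_mul_cross, toC_smul, smul_smul]
  congr 1
  push_cast
  field_simp

theorem cross_mul_T (k : Wave) : toC (cross k) * T k = (-Complex.I * ‖k‖) • toC (Pperp k) := by
  rw [← T_mul_cross, T, smul_mul_assoc, mul_smul_comm]

theorem Pperp_mul_T (k : Wave) : toC (Pperp k) * T k = T k := by
  rw [T, mul_smul_comm, ← toC_mul, Pperp_mul_cross]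

theorem T_mul_Pperp (k : Wave) : T k * toC (Pperp k) = T k := by
  rw [T, smul_mul_assoc, ← toC_mul, cross_mul_Pperp]

theorem T_mul_T_mul_cross (k : Wave) : T k * (T k * toC (cross k)) = toC (cross k) := by
  rw [T_mul_cross, mul_smul_comm, T_mul_Pperp, T, smul_smul]
  rcases eq_or_ne k 0 with rfl | hk
  · simp [cross_zero, toC]
  have hk' : (‖k‖ : ℂ) ≠ 0 := by exact_mod_cast (norm_pos_iff.2 hk).ne'
  have : -Complex.I * ‖k‖ * (Complex.I / ‖k‖) = 1 := by
    field_simp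
    simp
  rw [this, one_smul]

theorem cross_mul_T_mul_T (k : Wave) : toC (cross k) * (T k * T k) = toC (cross k) := by
  have h : Commute (T k) (toC (cross k)) := (T_mul_cross k).trans (cross_mul_T k).symm
  rw [← mul_assoc, ← h.eq, mul_assoc, ← h.eq, T_mul_T_mul_cross]

/-- At `k = 0` the square of `T k` is `0` while `Pperp k` is `1`; the factor `‖k‖ ^ 2` makes the
identity hold there too. -/
theorem norm_sq_smul_T_mul_T (k : Wave) :
    ((‖k‖ : ℂ) ^ 2) • (T k * T k) = ((‖k‖ : ℂ) ^ 2) • toC (Pperp k) := by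
  rcases eq_or_ne k 0 with rfl | hk
  · simp
  have hk' : (‖k‖ : ℂ) ≠ 0 := by exact_mod_cast (norm_pos_iff.2 hk).ne'
  nth_rw 2 [T]
  rw [mul_smul_comm, T_mul_cross, smul_smul, smul_smul]
  congr 1
  field_simp
  simp

theorem R22_mul_R22 : R22 * R22 = -1 := by
  ext i j; fin_cases i <;> fin_cases j <;> simp [R22, Matrix.mul_apply]

/-! ### The real form of `M k` and its quadratic form. -/

variable (p : Params)

/-- The real matrix whose complexification is `p.M k`: a symmetric matrix plus a bounded
antisymmetric one. -/
def realM (k : Wave) : Matrix Idx Idx ℝ :=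
  Matrix.fromBlocks
    ((-((p.μ + p.κ / 2) * ‖k‖ ^ 2)) • Pperp k)
    (Matrix.fromCols ((p.κ * ‖k‖) • (Pperp k * p.JInvSqrt)) 0)
    (Matrix.fromRows ((p.κ * ‖k‖) • (p.JInvSqrt * Pperp k)) 0)
    (Matrix.fromBlocks
      (-(2 * p.κ) • p.JInv
        - (p.αt * ‖k‖ ^ 2) • (p.JInvSqrt * Ppar k * p.JInvSqrt)
        - (p.γt * ‖k‖ ^ 2) • (p.JInvSqrt * Pperp k * p.JInvSqrt)
        - ((1 - p.nu / p.lam) * p.d) • R33)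
      ((p.d * √(p.lam - p.nu) / √p.lam) • !![1, 0; 0, 1; 0, 0])
      ((p.d * √(p.lam - p.nu) / √p.lam) • !![1, 0, 0; 0, 1, 0])
      (p.d • R22))

theorem JInv_eq (hl : 0 < p.lam) (hn : 0 < p.nu) : p.JInv = p.JInvSqrt * p.JInvSqrt := by
  rw [JInv, JInvSqrt, Matrix.diagonal_mul_diagonal]
  congr 1
  ext i
  fin_cases i <;> simp [← mul_inv, hl.le, hn.le]

theorem JSqrt_mul_JInvSqrt (hl : 0 < p.lam) (hn : 0 < p.nu) : p.JSqrt * p.JInvSqrt = 1 := by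
  rw [JSqrt, JInvSqrt, Matrix.diagonal_mul_diagonal, ← Matrix.diagonal_one]
  congr 1
  have := Real.sqrt_pos.2 hl
  have := Real.sqrt_pos.2 hn
  ext i
  fin_cases i <;> simp <;> field_simp

theorem JInvSqrt_mul_JSqrt (hl : 0 < p.lam) (hn : 0 < p.nu) : p.JInvSqrt * p.JSqrt = 1 :=
  mul_eq_one_comm.1 (JSqrt_mul_JInvSqrt p hl hn)

theorem JSqrt_mul_R33_mul_JInvSqrt (hl : 0 < p.lam) : p.JSqrt * R33 * p.JInvSqrt = R33 := by
  have := (Real.sqrt_pos.2 hl).ne'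
  ext i j
  fin_cases i <;> fin_cases j <;>
    simp [JSqrt, JInvSqrt, R33, this]

theorem s_ne_zero (hln : p.nu < p.lam) (hd : p.d ≠ 0) : p.s ≠ 0 := by
  have hsd := Real.sqrt_pos.2 (sub_pos.2 hln)
  exact mul_ne_zero (by simp [hsd.ne']) hd

/-- `T k` turns `i k ×` into the real symmetric `‖k‖ • Pperp k`, the roots of `J` symmetrize the
inertia, and `s` balances the two couplings of `ω` and `a`. -/
theorem M_eq (hl : 0 < p.lam) (hn : 0 < p.nu) (hln : p.nu < p.lam) (hd : p.d ≠ 0) (k : Wave) :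
    p.M k = (realM p k).map Complex.ofReal := by
  have hJ : p.JSqrt * p.JInv = p.JInvSqrt := by
    rw [JInv_eq p hl hn, ← mul_assoc, JSqrt_mul_JInvSqrt p hl hn, one_mul]
  have hsl := Real.sqrt_pos.2 hl
  have hsd := Real.sqrt_pos.2 (sub_pos.2 hln)
  have hsl2 := Real.sq_sqrt hl.le
  have hsd2 := Real.sq_sqrt (sub_pos.2 hln).le
  have hs := s_ne_zero p hln hd
  rw [M, Q, symbolB, Qbar, blocks_diagonal_mul_blocks_mul_diagonal]
  have h11 : T k * toC ((-((p.μ + p.κ / 2) * ‖k‖ ^ 2)) • Pperp k) * T k =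
      toC ((-((p.μ + p.κ / 2) * ‖k‖ ^ 2)) • Pperp k) := by
    rw [toC_smul, mul_smul_comm, T_mul_Pperp, smul_mul_assoc]
    have := congrArg (fun A => (p.μ + p.κ / 2 : ℂ) • A) (norm_sq_smul_T_mul_T k)
    simpa [smul_smul] using this
  have h12 : T k * ((Complex.I * (p.κ : ℂ)) • toC (cross k)) * toC p.JInvSqrt =
      toC ((p.κ * ‖k‖) • (Pperp k * p.JInvSqrt)) := by
    rw [mul_smul_comm, T_mul_cross, smul_smul, smul_mul_assoc, ← toC_mul, toC_smul]
    congr 1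
    push_cast
    linear_combination (-p.κ * ‖k‖ : ℂ) * Complex.I_sq
  have h21 : toC p.JSqrt * (toC p.JInv * ((Complex.I * (p.κ : ℂ)) • toC (cross k)) *
      toC (Pperp k)) * T k = toC ((p.κ * ‖k‖) • (p.JInvSqrt * Pperp k)) := by
    rw [mul_assoc, mul_assoc, mul_assoc, Pperp_mul_T, smul_mul_assoc, cross_mul_T, smul_smul,
      mul_smul_comm, mul_smul_comm, ← toC_mul, ← toC_mul, ← Matrix.mul_assoc, hJ, toC_smul]
    congr 1
    push_cast
    linear_combination (-p.κ * ‖k‖ : ℂ) * Complex.I_sq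
  have h22 : p.JSqrt * (-(2 * p.κ) • p.JInv
        - (p.αt * ‖k‖ ^ 2) • (p.JInv * Ppar k)
        - (p.γt * ‖k‖ ^ 2) • (p.JInv * Pperp k)
        - ((1 - p.nu / p.lam) * p.d) • R33) * p.JInvSqrt = -(2 * p.κ) • p.JInv
        - (p.αt * ‖k‖ ^ 2) • (p.JInvSqrt * Ppar k * p.JInvSqrt)
        - (p.γt * ‖k‖ ^ 2) • (p.JInvSqrt * Pperp k * p.JInvSqrt)
        - ((1 - p.nu / p.lam) * p.d) • R33 := by
    simp only [mul_sub, sub_mul, mul_smul_comm, smul_mul_assoc, ← mul_assoc, one_mul,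
      JSqrt_mul_JInvSqrt p hl hn,
      JSqrt_mul_R33_mul_JInvSqrt p hl, JInv_eq p hl hn]
  -- The value of `s` is the one for which this scalar agrees with that of `h32`.
  have h23 : p.JSqrt * (-(1 / p.lam * p.d ^ 2) • R32) * ((-p.s⁻¹) • R22) =
      (p.d * √(p.lam - p.nu) / √p.lam) • !![1, 0; 0, 1; 0, 0] := by
    have hsc : √p.lam * (-(1 / p.lam * p.d ^ 2)) * p.s⁻¹ =
        p.d * √(p.lam - p.nu) / √p.lam := by
      rw [s, ← hsl2, Real.sqrt_sq hsl.le]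
      field_simp
    rw [← hsc]
    ext i j
    fin_cases i <;> fin_cases j <;>
      simp [JSqrt, R32, R22, Matrix.mul_apply, Fin.sum_univ_three]
  have h32 : p.s • R22 * ((p.lam - p.nu) • R23) * p.JInvSqrt =
      (p.d * √(p.lam - p.nu) / √p.lam) • !![1, 0, 0; 0, 1, 0] := by
    have hsc : -(p.s * (p.lam - p.nu) * (√p.lam)⁻¹) = p.d * √(p.lam - p.nu) / √p.lam := by
      rw [s, ← hsd2, Real.sqrt_sq hsd.le]
      field_simp
    rw [← hsc]
    ext i j
    fin_cases i <;> fin_cases j <;>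
      simp [JInvSqrt, R23, R22, Matrix.mul_apply, Fin.sum_univ_three]
    all_goals ring
  have h33 : p.s • R22 * (p.d • R22) * ((-p.s⁻¹) • R22) = p.d • R22 := by
    ext i j
    fin_cases i <;> fin_cases j <;> simp [R22, Matrix.mul_apply] <;> field_simp
  have hm : ∀ {l m : Type} [Fintype l] [Fintype m] (A : Matrix l l ℝ) (B : Matrix l m ℝ)
      (C : Matrix m m ℝ), toC A * toC B * toC C = toC (A * B * C) := by
    intro l m _ _ A B C
    rw [toC_mul, toC_mul]
  rw [h11, h12, h21, hm, h22, hm, h23, hm, h32, hm, h33]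
  simp only [Matrix.mul_zero, Matrix.zero_mul]
  rw [realM, Matrix.fromBlocks_map]
  unfold blocks toC
  congr 1
  all_goals ext i j; rcases i with i | i <;> rcases j with j | j <;> simp

theorem dotProduct_realM_mulVec (hl : 0 < p.lam) (hn : 0 < p.nu) (k : Wave) (hk : k ≠ 0)
    (u ω : Fin 3 → ℝ) (a : Fin 2 → ℝ) (y : Fin 3 → ℝ) (hy : y = p.JInvSqrt *ᵥ ω) :
    Sum.elim u (Sum.elim ω a) ⬝ᵥ realM p k *ᵥ Sum.elim u (Sum.elim ω a) =
      -(p.μ + p.κ / 2) * (‖k‖ ^ 2 * (u 0 ^ 2 + u 1 ^ 2 + u 2 ^ 2) -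
        (k 0 * u 0 + k 1 * u 1 + k 2 * u 2) ^ 2) +
      2 * p.κ * (‖k‖ * (u 0 * y 0 + u 1 * y 1 + u 2 * y 2) -
        (k 0 * u 0 + k 1 * u 1 + k 2 * u 2) * (k 0 * y 0 + k 1 * y 1 + k 2 * y 2) / ‖k‖) -
      2 * p.κ * (y 0 ^ 2 + y 1 ^ 2 + y 2 ^ 2) -
      p.αt * (k 0 * y 0 + k 1 * y 1 + k 2 * y 2) ^ 2 -
      p.γt * (‖k‖ ^ 2 * (y 0 ^ 2 + y 1 ^ 2 + y 2 ^ 2) -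
        (k 0 * y 0 + k 1 * y 1 + k 2 * y 2) ^ 2) +
      2 * (p.d * √(p.lam - p.nu) / √p.lam) * (ω 0 * a 0 + ω 1 * a 1) := by
  have hk' : ‖k‖ ≠ 0 := norm_ne_zero_iff.2 hk
  rw [realM, JInv_eq p hl hn]
  have hy0 : y 0 = (√p.lam)⁻¹ * ω 0 := by simp [hy, JInvSqrt, Matrix.mulVec_diagonal]
  have hy1 : y 1 = (√p.lam)⁻¹ * ω 1 := by simp [hy, JInvSqrt, Matrix.mulVec_diagonal]
  have hy2 : y 2 = (√p.nu)⁻¹ * ω 2 := by simp [hy, JInvSqrt, Matrix.mulVec_diagonal]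
  rw [hy0, hy1, hy2, JInvSqrt]
  -- Once the parameter quotients are opaque, the denominators left to clear are powers of `‖k‖`.
  generalize (√p.lam)⁻¹ = r
  generalize (√p.nu)⁻¹ = q
  generalize p.d * √(p.lam - p.nu) / √p.lam = c
  generalize (1 - p.nu / p.lam) * p.d = e
  generalize p.αt = α
  generalize p.γt = γ
  simp [dotProduct, Matrix.mulVec, Fintype.sum_sum_type, Fin.sum_univ_three, Pperp, Ppar,
    R33, R22, Matrix.diagonal_mul, Matrix.mul_diagonal, -Matrix.diagonal_mul_diagonal,
    Matrix.fromRows_apply_inl, Matrix.fromRows_apply_inr, Matrix.fromCols_apply_inl,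
    Matrix.fromCols_apply_inr]
  field_simp
  ring

/-! ### Energy estimate for nonzero wavenumbers. -/

theorem two_mul_le_of_sq_le {m η c x y : ℝ} (hη : 0 < η) (h : c ^ 2 ≤ m * η) :
    2 * c * (x * y) ≤ m * x ^ 2 + η * y ^ 2 := by
  refine le_of_mul_le_mul_left ?_ hη
  nlinarith [sq_nonneg (c * x - η * y), mul_le_mul_of_nonneg_right h (sq_nonneg x)]

-- With `y = (r * w₀, r * w₁, q * w₂)`, the forms in `u` and `y` are written through `k × u` and `k
-- × y`, and two applications of Young's inequality absorb the couplings.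
set_option maxHeartbeats 800000 in
theorem energy_le {μ κ α γ m η c r q n k₀ k₁ k₂ u₀ u₁ u₂ w₀ w₁ w₂ a₀ a₁ : ℝ}
    (hμ : 0 ≤ μ) (hκ : 0 ≤ κ) (hm : 0 ≤ m) (hα : m ≤ α) (hγ : m ≤ γ) (hn : 0 < n)
    (hk : n ^ 2 = k₀ ^ 2 + k₁ ^ 2 + k₂ ^ 2) (hη : 0 < η)
    (hc : c ^ 2 ≤ m * n ^ 2 * r ^ 2 * η) :
    -(μ + κ / 2) * (n ^ 2 * (u₀ ^ 2 + u₁ ^ 2 + u₂ ^ 2) - (k₀ * u₀ + k₁ * u₁ + k₂ * u₂) ^ 2) +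
      2 * κ * (n * (u₀ * (r * w₀) + u₁ * (r * w₁) + u₂ * (q * w₂)) -
        (k₀ * u₀ + k₁ * u₁ + k₂ * u₂) * (k₀ * (r * w₀) + k₁ * (r * w₁) + k₂ * (q * w₂)) / n) -
      2 * κ * ((r * w₀) ^ 2 + (r * w₁) ^ 2 + (q * w₂) ^ 2) -
      α * (k₀ * (r * w₀) + k₁ * (r * w₁) + k₂ * (q * w₂)) ^ 2 -
      γ * (n ^ 2 * ((r * w₀) ^ 2 + (r * w₁) ^ 2 + (q * w₂) ^ 2) -
        (k₀ * (r * w₀) + k₁ * (r * w₁) + k₂ * (q * w₂)) ^ 2) +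
      2 * c * (w₀ * a₀ + w₁ * a₁) ≤ η * (a₀ ^ 2 + a₁ ^ 2) := by
  have h0 := two_mul_le_of_sq_le (x := w₀) (y := a₀) hη hc
  have h1 := two_mul_le_of_sq_le (x := w₁) (y := a₁) hη hc
  have hm2 : 0 ≤ m * n ^ 2 * (q * w₂) ^ 2 := by positivity
  set y₀ := r * w₀ with hy₀
  set y₁ := r * w₁ with hy₁
  set y₂ := q * w₂
  set A := (k₁ * u₂ - k₂ * u₁) with hA
  set B := (k₂ * u₀ - k₀ * u₂) with hB
  set C := (k₀ * u₁ - k₁ * u₀) with hC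
  set D := (k₁ * y₂ - k₂ * y₁) with hD
  set E := (k₂ * y₀ - k₀ * y₂) with hE
  set F := (k₀ * y₁ - k₁ * y₀) with hF
  set S := k₀ * y₀ + k₁ * y₁ + k₂ * y₂ with hS
  -- Lagrange's identity gives `hU` and `hY`; its polarized form, with `(D, E, F) = k × y`, gives
  -- `hX`.
  have hU : n ^ 2 * (u₀ ^ 2 + u₁ ^ 2 + u₂ ^ 2) - (k₀ * u₀ + k₁ * u₁ + k₂ * u₂) ^ 2 =
      A ^ 2 + B ^ 2 + C ^ 2 := by rw [hk, hA, hB, hC]; ring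
  have hY : n ^ 2 * (y₀ ^ 2 + y₁ ^ 2 + y₂ ^ 2) - S ^ 2 = D ^ 2 + E ^ 2 + F ^ 2 := by
    rw [hk, hD, hE, hF, hS]; ring
  have hX : n * (u₀ * y₀ + u₁ * y₁ + u₂ * y₂) - (k₀ * u₀ + k₁ * u₁ + k₂ * u₂) * S / n =
      A * (D / n) + B * (E / n) + C * (F / n) := by
    field_simp
    rw [hk, hA, hB, hC, hD, hE, hF, hS]; ring
  have hYn : (D / n) ^ 2 + (E / n) ^ 2 + (F / n) ^ 2 ≤ y₀ ^ 2 + y₁ ^ 2 + y₂ ^ 2 := by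
    rw [div_pow, div_pow, div_pow, ← add_div, ← add_div, div_le_iff₀ (by positivity), ← hY]
    linarith [sq_nonneg S]
  rw [hU, hY, hX]
  -- The two terms on the right are exactly the `κ / 2` part of the viscosity and the friction `2 *
  -- κ * |y| ^ 2`.
  have hcross : 2 * κ * (A * (D / n) + B * (E / n) + C * (F / n)) ≤
      κ / 2 * (A ^ 2 + B ^ 2 + C ^ 2) + 2 * κ * (y₀ ^ 2 + y₁ ^ 2 + y₂ ^ 2) := by
    have h2 : 2 * (A * (D / n) + B * (E / n) + C * (F / n)) ≤
        1 / 2 * (A ^ 2 + B ^ 2 + C ^ 2) + 2 * ((D / n) ^ 2 + (E / n) ^ 2 + (F / n) ^ 2) := by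
      have h (x y : ℝ) : 2 * (x * y) ≤ 1 / 2 * x ^ 2 + 2 * y ^ 2 := by
        linarith [sq_nonneg (x - 2 * y)]
      linarith [h A (D / n), h B (E / n), h C (F / n)]
    have h3 := mul_le_mul_of_nonneg_left (h2.trans (add_le_add_right
      (mul_le_mul_of_nonneg_left hYn two_pos.le) _)) hκ
    linarith
  have hμU : 0 ≤ μ * (A ^ 2 + B ^ 2 + C ^ 2) := by positivity
  have hαS := mul_le_mul_of_nonneg_right hα (sq_nonneg S)
  have hγY := mul_le_mul_of_nonneg_right hγ (by positivity : 0 ≤ D ^ 2 + E ^ 2 + F ^ 2)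
  -- The longitudinal and transverse dissipation together control `m * n ^ 2 * |y| ^ 2`, whose first
  -- two components pay for `h0` and `h1`; the third is dropped by `hm2`.
  have hsum : m * S ^ 2 + m * (D ^ 2 + E ^ 2 + F ^ 2) =
      m * n ^ 2 * r ^ 2 * w₀ ^ 2 + m * n ^ 2 * r ^ 2 * w₁ ^ 2 + m * n ^ 2 * y₂ ^ 2 := by
    rw [← hY, hy₀, hy₁]; ring
  linarith

theorem dotProduct_realM_mulVec_le (hμ : 0 < p.μ) (hκ : 0 < p.κ) (hl : 0 < p.lam)
    (hn : 0 < p.nu) {m η : ℝ} (hm : 0 ≤ m) (hα : m ≤ p.αt) (hγ : m ≤ p.γt) (hη : 0 < η)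
    (k : Wave) (hk : k ≠ 0)
    (hc : (p.d * √(p.lam - p.nu)) ^ 2 ≤ m * ‖k‖ ^ 2 * η) (x : Idx → ℝ) :
    x ⬝ᵥ realM p k *ᵥ x ≤ η * ∑ i, x i ^ 2 := by
  obtain ⟨u, ω, a, rfl⟩ : ∃ (u ω : Fin 3 → ℝ) (a : Fin 2 → ℝ),
      x = Sum.elim u (Sum.elim ω a) :=
    ⟨fun i => x (.inl i), fun i => x (.inr (.inl i)), fun i => x (.inr (.inr i)), by
      ext i; rcases i with i | i | i <;> rfl⟩
  rw [dotProduct_realM_mulVec p hl hn k hk u ω a _ rfl]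
  have hr : (√p.lam)⁻¹ ^ 2 * p.lam = 1 := by
    rw [inv_pow, Real.sq_sqrt hl.le, inv_mul_cancel₀ hl.ne']
  have hc' : (p.d * √(p.lam - p.nu) / √p.lam) ^ 2 ≤ m * ‖k‖ ^ 2 * (√p.lam)⁻¹ ^ 2 * η := by
    rw [div_eq_mul_inv, mul_pow]
    nlinarith [mul_le_mul_of_nonneg_right hc (sq_nonneg (√p.lam)⁻¹)]
  have h := energy_le (q := (√p.nu)⁻¹) (u₀ := u 0) (u₁ := u 1) (u₂ := u 2) (w₀ := ω 0)
    (w₁ := ω 1) (w₂ := ω 2) (a₀ := a 0) (a₁ := a 1)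
    hμ.le hκ.le hm hα hγ (norm_pos_iff.2 hk) (norm_sq_wave k) hη hc'
  simp only [JInvSqrt, Matrix.mulVec_diagonal]
  refine le_trans h ?_
  refine mul_le_mul_of_nonneg_left ?_ hη.le
  simp only [Fintype.sum_sum_type, Sum.elim_inl, Sum.elim_inr, Fin.sum_univ_three,
    Fin.sum_univ_two]
  linarith [sq_nonneg (u 0), sq_nonneg (u 1), sq_nonneg (u 2), sq_nonneg (ω 0),
    sq_nonneg (ω 1), sq_nonneg (ω 2)]

/-! ### The unstable eigenvalue at `k = 0`. -/

theorem exists_root_re_pos {a c : ℝ} (b d : ℝ) (ha : 0 < a) (hc : c ≠ 0) :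
    ∃ w : ℂ, 0 < w.re ∧ (w + a + Complex.I * b) * (w - Complex.I * d) = c ^ 2 := by
  set g : ℂ := a + Complex.I * (b + d) with hg
  obtain ⟨s, hs, hs0⟩ : ∃ s : ℂ, s ^ 2 = g ^ 2 + 4 * c ^ 2 ∧ 0 ≤ s.re := by
    obtain ⟨s, hs⟩ := IsAlgClosed.exists_pow_nat_eq (g ^ 2 + 4 * (c : ℂ) ^ 2) two_pos
    rcases le_total 0 s.re with h | h
    · exact ⟨s, hs, h⟩
    · exact ⟨-s, by rw [neg_sq, hs], by simpa using h⟩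
  refine ⟨Complex.I * d + (-g + s) / 2, ?_, ?_⟩
  · have hre := congrArg Complex.re hs
    have him := congrArg Complex.im hs
    simp [hg, sq, -mul_eq_mul_left_iff] at hre him
    -- If `s.re ≤ a`, the real part of `s ^ 2` forces `s.im ^ 2 < (b + d) ^ 2`, and then the
    -- imaginary part, `s.re * s.im = a * (b + d)`, cannot hold.
    have hlt : a < s.re := by
      by_contra! hle
      have hp : s.re ^ 2 ≤ a ^ 2 := pow_le_pow_left₀ hs0 hle 2
      have hc2 : 0 < c ^ 2 := by positivity
      have hq : s.im ^ 2 < (b + d) ^ 2 := by nlinarith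
      have hpq : s.re * s.im = a * (b + d) := by linarith
      have h1 : s.re ^ 2 * s.im ^ 2 = a ^ 2 * (b + d) ^ 2 := by rw [← mul_pow, hpq, mul_pow]
      have h2 : s.re ^ 2 * s.im ^ 2 ≤ a ^ 2 * s.im ^ 2 :=
        mul_le_mul_of_nonneg_right hp (sq_nonneg _)
      have h3 : a ^ 2 * s.im ^ 2 < a ^ 2 * (b + d) ^ 2 :=
        mul_lt_mul_of_pos_left hq (by positivity)
      linarith
    simp [hg]
    linarith
  · linear_combination hs / 4 - (Complex.I * d + (-g + s) / 2 - Complex.I * d) * hg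

theorem exists_hasEigenvalue_M_zero (hκ : 0 < p.κ) (hn : 0 < p.nu)
    (hln : p.nu < p.lam) (hd : p.d ≠ 0) :
    ∃ w : ℂ, 0 < w.re ∧ Module.End.HasEigenvalue (Matrix.toLin' (p.M 0)) w := by
  have hl := hn.trans hln
  have hsl := Real.sqrt_pos.2 hl
  have hsd := Real.sqrt_pos.2 (sub_pos.2 hln)
  have hc : p.d * √(p.lam - p.nu) / √p.lam ≠ 0 := by positivity
  obtain ⟨w, hw, hroot⟩ := exists_root_re_pos (a := 2 * p.κ / p.lam)
    ((1 - p.nu / p.lam) * p.d) p.d (by positivity) hc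
  refine ⟨w, hw, ?_⟩
  rw [M_eq p hl hn hln hd]
  have hJ : p.JInv 0 0 = p.lam⁻¹ ∧ p.JInv 1 1 = p.lam⁻¹ ∧ p.JInv 0 1 = 0 ∧ p.JInv 1 0 = 0 ∧
      p.JInv 2 0 = 0 ∧ p.JInv 2 1 = 0 := by simp [JInv]
  obtain ⟨h00, h11, h01, h10, h20, h21⟩ := hJ
  simp only [realM, norm_zero]
  revert hroot hc
  generalize p.d * √(p.lam - p.nu) / √p.lam = c
  generalize (1 - p.nu / p.lam) * p.d = b
  intro hc hroot
  set x := w - Complex.I * p.d with hx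
  -- In the plane `(1, -i)` is an eigenvector of the rotation generator, with eigenvalue `i`. On
  -- multiples of it in `ω` and `a`, the matrix reduces to a `2 × 2` one whose characteristic
  -- equation is `hroot`.
  refine Module.End.hasEigenvalue_of_hasEigenvector
    (x := Sum.elim 0 (Sum.elim ![x, -Complex.I * x, 0] ![(c : ℂ), -Complex.I * c]))
    ⟨Module.End.mem_eigenspace_iff.2 ?_, ?_⟩
  · rw [Matrix.toLin'_apply]
    ext i
    rcases i with i | i | i <;> fin_cases i <;>
      simp [dotProduct, Matrix.mulVec, Fintype.sum_sum_type, Fin.sum_univ_three, R33, R22,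
        h00, h11, h01, h10, h20, h21]
    all_goals push_cast at hroot
    · linear_combination -hroot
    · linear_combination Complex.I * hroot - b * x * Complex.I_sq
    · linear_combination c * hx
    · linear_combination -Complex.I * c * hx + p.d * c * Complex.I_sq
  · intro h0
    have := congrFun h0 (Sum.inr (Sum.inr 0))
    simp [hc] at this

/-! ### Return from `M k` to the symbol. -/

theorem blocks_mul_blocks_diagonal
    (L₁ L₂ R₁ R₂ : Matrix (Fin 3) (Fin 3) ℂ) (L₃ R₃ : Matrix (Fin 2) (Fin 2) ℂ) :
    blocks L₁ 0 0 0 L₂ 0 0 0 L₃ * blocks R₁ 0 0 0 R₂ 0 0 0 R₃ =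
      blocks (L₁ * R₁) 0 0 0 (L₂ * R₂) 0 0 0 (L₃ * R₃) := by
  have := blocks_diagonal_mul_blocks_mul_diagonal L₁ L₂ 1 1 L₃ 1 R₁ 0 0 R₂ 0 0 0 0 R₃
  simpa [blocks_one] using this

theorem Qbar_mul_Q (hn : 0 < p.nu) (hln : p.nu < p.lam) (hd : p.d ≠ 0) (k : Wave) :
    p.Qbar k * p.Q k = blocks (T k * T k) 0 0 0 1 0 0 0 1 := by
  rw [Qbar, Q, blocks_mul_blocks_diagonal, ← toC_mul, ← toC_mul,
    JInvSqrt_mul_JSqrt p (hn.trans hln) hn, toC_one]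
  have : (-p.s⁻¹) • R22 * p.s • R22 = 1 := by
    rw [smul_mul_assoc, mul_smul_comm, R22_mul_R22, smul_smul, smul_neg, neg_mul,
      inv_mul_cancel₀ (s_ne_zero p hln hd), neg_smul, one_smul, neg_neg]
  rw [this, toC_one]

theorem symbolB_mul_Qbar_mul_Q (hn : 0 < p.nu) (hln : p.nu < p.lam) (hd : p.d ≠ 0) (k : Wave) :
    p.symbolB k * (p.Qbar k * p.Q k) = p.symbolB k := by
  rw [Qbar_mul_Q p hn hln hd, ← one_mul (p.symbolB k), ← blocks_one, symbolB,
    blocks_diagonal_mul_blocks_mul_diagonal]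
  have h11 : toC ((-((p.μ + p.κ / 2) * ‖k‖ ^ 2)) • Pperp k) * (T k * T k) =
      toC ((-((p.μ + p.κ / 2) * ‖k‖ ^ 2)) • Pperp k) := by
    rw [toC_smul, smul_mul_assoc, ← mul_assoc, Pperp_mul_T]
    have := congrArg (fun A => (p.μ + p.κ / 2 : ℂ) • A) (norm_sq_smul_T_mul_T k)
    simpa [smul_smul] using this
  have h21 (X : Matrix (Fin 3) (Fin 3) ℂ) (c : ℂ) :
      X * (c • toC (cross k)) * toC (Pperp k) * (T k * T k) =
        X * (c • toC (cross k)) * toC (Pperp k) := by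
    rw [mul_assoc X, smul_mul_assoc, ← toC_mul, cross_mul_Pperp, mul_assoc, smul_mul_assoc,
      cross_mul_T_mul_T]
  simp only [one_mul, mul_one, Matrix.one_mul, Matrix.mul_one, Matrix.zero_mul,
    h11, h21, blocks_one]

theorem Qbar_mul_Q_mul_symbolB (hn : 0 < p.nu) (hln : p.nu < p.lam) (hd : p.d ≠ 0) (k : Wave) :
    p.Qbar k * p.Q k * p.symbolB k = p.symbolB k := by
  rw [Qbar_mul_Q p hn hln hd, ← mul_one (_ * _), ← blocks_one, symbolB,
    blocks_diagonal_mul_blocks_mul_diagonal]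
  have h11 : T k * T k * toC ((-((p.μ + p.κ / 2) * ‖k‖ ^ 2)) • Pperp k) =
      toC ((-((p.μ + p.κ / 2) * ‖k‖ ^ 2)) • Pperp k) := by
    rw [toC_smul, mul_smul_comm, mul_assoc, T_mul_Pperp]
    have := congrArg (fun A => (p.μ + p.κ / 2 : ℂ) • A) (norm_sq_smul_T_mul_T k)
    simpa [smul_smul] using this
  have h12 (c : ℂ) : T k * T k * (c • toC (cross k)) = c • toC (cross k) := by
    rw [mul_smul_comm, mul_assoc, T_mul_T_mul_cross]
  simp only [one_mul, mul_one, Matrix.one_mul, Matrix.mul_one, Matrix.mul_zero,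
    h11, h12]

/-- The symbol is fixed by `Qbar k * Q k` on either side. Hence `Q k` intertwines it with `M k`, and
`1 - Qbar k * Q k` intertwines it with `0`; both relations pass to exponentials. -/
theorem exp_smul_symbolB (hn : 0 < p.nu) (hln : p.nu < p.lam) (hd : p.d ≠ 0) (k : Wave)
    (z : ℂ) : NormedSpace.exp (z • p.symbolB k) =
      1 - p.Qbar k * p.Q k + p.Qbar k * NormedSpace.exp (z • p.M k) * p.Q k := by
  let _ : NormedAlgebra ℚ (Matrix Idx Idx ℂ) := NormedAlgebra.restrictScalars ℚ ℂ _
  have h1 : SemiconjBy (p.Q k) (z • p.symbolB k) (z • p.M k) := by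
    rw [SemiconjBy, mul_smul_comm, smul_mul_assoc, M, mul_assoc, mul_assoc,
      symbolB_mul_Qbar_mul_Q p hn hln hd]
  have h2 : SemiconjBy (1 - p.Qbar k * p.Q k) (z • p.symbolB k) 0 := by
    rw [SemiconjBy, mul_smul_comm, sub_mul, one_mul, Qbar_mul_Q_mul_symbolB p hn hln hd,
      sub_self, smul_zero, zero_mul]
  have h1' := h1.exp_right
  have h2' := h2.exp_right
  rw [SemiconjBy] at h1' h2'
  rw [NormedSpace.exp_zero, one_mul, sub_mul, one_mul, sub_eq_iff_eq_add] at h2'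
  rw [mul_assoc, ← h1', ← mul_assoc]
  exact h2'

theorem norm_T_apply_le (k : Wave) (i j : Fin 3) : ‖T k i j‖ ≤ 1 := by
  have h (i : Fin 3) : |k i| / ‖k‖ ≤ 1 :=
    div_le_one_of_le₀ (PiLp.norm_apply_le k i) (norm_nonneg k)
  have h0 := h 0
  have h1 := h 1
  have h2 := h 2
  fin_cases i <;> fin_cases j <;>
    simp [T, toC, cross, div_mul_eq_mul_div, h0, h1, h2]

/-- Only the block `T k` depends on `k`, and its entries are at most `1` in modulus because `|k i| ≤
‖k‖`. -/
theorem exists_norm_blocks_T_le (A : Matrix (Fin 3) (Fin 3) ℂ) (B : Matrix (Fin 2) (Fin 2) ℂ) :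
    ∃ C : ℝ, 0 ≤ C ∧ ∀ k : Wave, ‖blocks (T k) 0 0 0 A 0 0 0 B‖ ≤ C := by
  obtain ⟨C, hC, h⟩ := Matrix.exists_norm_le_of_norm_apply_le Idx 1
  refine ⟨C + ‖blocks 0 0 0 0 A 0 0 0 B‖, by positivity, fun k => ?_⟩
  have hsum : blocks (T k) 0 0 0 A 0 0 0 B =
      blocks (T k) 0 0 0 0 0 0 0 0 + blocks 0 0 0 0 A 0 0 0 B := by
    simp [blocks, Matrix.fromBlocks_add]
  rw [hsum]
  refine (norm_add_le _ _).trans (add_le_add_left (h _ fun i j => ?_) _)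
  rcases i with i | i | i <;> rcases j with j | j | j <;> simp [blocks, norm_T_apply_le]

theorem one_add_pow_mul_exp_le {ε t : ℝ} (hε : 0 < ε) (ht : 0 ≤ t) (η : ℝ) (n : ℕ) :
    (1 + t ^ n) * Real.exp (η * t) ≤
      (1 + n.factorial / ε ^ n) * Real.exp ((η + ε) * t) := by
  have h1 := Real.pow_div_factorial_le_exp (ε * t) (by positivity) n
  have h2 : t ^ n ≤ n.factorial / ε ^ n * Real.exp (ε * t) := by
    rw [mul_pow, div_le_iff₀ (by positivity)] at h1
    rw [div_mul_eq_mul_div, le_div_iff₀ (by positivity)]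
    linarith
  have h3 : 1 ≤ Real.exp (ε * t) := Real.one_le_exp (by positivity)
  rw [add_mul η, add_comm (η * t), Real.exp_add, ← mul_assoc]
  refine mul_le_mul_of_nonneg_right ?_ (Real.exp_pos _).le
  linarith

theorem exists_norm_exp_smul_symbolB_le (hn : 0 < p.nu) (hln : p.nu < p.lam) (hd : p.d ≠ 0)
    {C η ε : ℝ} {n : ℕ} (S : Set Wave) (hC : 0 < C) (hη : 0 < η) (hε : 0 < ε)
    (h : ∀ k ∈ S, ∀ t : ℝ, 0 < t →
      ‖NormedSpace.exp ((t : ℂ) • p.M k)‖ ≤ C * (1 + t ^ n) * Real.exp (η * t)) :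
    ∃ C' : ℝ, 0 < C' ∧ ∀ k ∈ S, ∀ t : ℝ, 0 < t →
      ‖NormedSpace.exp ((t : ℂ) • p.symbolB k)‖ ≤ C' * Real.exp ((η + ε) * t) := by
  obtain ⟨C₁, hC₁, h₁⟩ := exists_norm_blocks_T_le (toC p.JSqrt) (toC (p.s • R22))
  obtain ⟨C₂, hC₂, h₂⟩ := exists_norm_blocks_T_le (toC p.JInvSqrt) (toC ((-p.s⁻¹) • R22))
  refine ⟨‖(1 : Matrix Idx Idx ℂ)‖ + C₂ * C₁ +
    C₂ * (C * (1 + n.factorial / ε ^ n)) * C₁ + 1, by positivity, fun k hk t ht => ?_⟩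
  rw [exp_smul_symbolB p hn hln hd]
  -- Positivity of the rate lets the exponential dominate the constant term `1 - Qbar k * Q k`.
  have hexp : 1 ≤ Real.exp ((η + ε) * t) := Real.one_le_exp (by positivity)
  have hM : ‖NormedSpace.exp ((t : ℂ) • p.M k)‖ ≤
      C * (1 + n.factorial / ε ^ n) * Real.exp ((η + ε) * t) := by
    refine (h k hk t ht).trans ?_
    rw [mul_assoc, mul_assoc]
    exact mul_le_mul_of_nonneg_left (one_add_pow_mul_exp_le hε ht.le η n) hC.le
  have hQ : ‖p.Q k‖ ≤ C₁ := h₁ k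
  have hQ' : ‖p.Qbar k‖ ≤ C₂ := h₂ k
  have ha : ‖1 - p.Qbar k * p.Q k‖ ≤ ‖(1 : Matrix Idx Idx ℂ)‖ + C₂ * C₁ :=
    (norm_sub_le _ _).trans (add_le_add_right ((norm_mul_le _ _).trans
      (mul_le_mul hQ' hQ (norm_nonneg _) hC₂)) _)
  have hb : ‖p.Qbar k * NormedSpace.exp ((t : ℂ) • p.M k) * p.Q k‖ ≤
      C₂ * (C * (1 + n.factorial / ε ^ n) * Real.exp ((η + ε) * t)) * C₁ :=
    (norm_mul_le _ _).trans (mul_le_mul ((norm_mul_le _ _).trans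
      (mul_le_mul hQ' hM (norm_nonneg _) hC₂)) hQ (norm_nonneg _) (by positivity))
  refine (norm_add_le _ _).trans ((add_le_add ha hb).trans ?_)
  have : ‖(1 : Matrix Idx Idx ℂ)‖ + C₂ * C₁ ≤
      (‖(1 : Matrix Idx Idx ℂ)‖ + C₂ * C₁) * Real.exp ((η + ε) * t) :=
    le_mul_of_one_le_right (by positivity) hexp
  linarith

/-! ### Reduction to finitely many wavenumbers. -/

theorem finite_setOf_norm_latticeVec_sq_le (r : ℝ) :
    {k : Fin 3 → ℤ | ‖latticeVec k‖ ^ 2 ≤ r}.Finite := by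
  refine (Set.finite_Icc (fun _ : Fin 3 => -⌈r⌉) (fun _ => ⌈r⌉)).subset fun k hk => ?_
  have h (i : Fin 3) : |k i| ≤ ⌈r⌉ := by
    have h1 : |(k i : ℝ)| ≤ ‖latticeVec k‖ := PiLp.norm_apply_le (latticeVec k) i
    have h2 : (k i : ℝ) ^ 2 ≤ r := (sq_le_sq' (by linarith [neg_abs_le (k i : ℝ)])
      ((le_abs_self _).trans h1)).trans hk
    -- For integers `|k i| ≤ k i ^ 2`, so the box needs no square root of `r`.
    have h3 : |k i| ≤ k i ^ 2 := by
      rw [← sq_abs]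
      exact Int.le_self_sq _
    have h4 : ((k i ^ 2 : ℤ) : ℝ) ≤ (⌈r⌉ : ℤ) := by
      push_cast
      exact h2.trans (Int.le_ceil r)
    exact h3.trans (Int.cast_le.1 h4)
  exact ⟨fun i => (abs_le.1 (h i)).1, fun i => (abs_le.1 (h i)).2⟩

theorem latticeVec_zero : latticeVec 0 = 0 := by
  ext i
  simp [latticeVec]

/-- Wavenumbers outside `F` cannot exceed the rate of `w₀`, so the maximum is taken over `w₀.re` and
the finitely many eigenvalues coming from `F`. -/
theorem exists_isGreatest_growthRates (p : Params) (w₀ : ℂ)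
    (hw₀ : Module.End.HasEigenvalue (Matrix.toLin' (p.M 0)) w₀) (F : Set (Fin 3 → ℤ))
    (hF : F.Finite)
    (h : ∀ k ∉ F, ∀ w, Module.End.HasEigenvalue (Matrix.toLin' (p.M (latticeVec k))) w →
      w.re ≤ w₀.re) :
    ∃ η, w₀.re ≤ η ∧ IsGreatest p.growthRates η := by
  let S : Set ℝ := insert w₀.re (⋃ k ∈ F,
    Complex.re '' {w | Module.End.HasEigenvalue (Matrix.toLin' (p.M (latticeVec k))) w})
  have hS : S.Finite := (hF.biUnion fun k _ => (Module.End.finite_hasEigenvalue _).image _).insert _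
  obtain ⟨η, hηS, hη⟩ := Set.exists_max_image S id hS ⟨_, Set.mem_insert _ _⟩
  have h0 : w₀.re ≤ η := hη _ (Set.mem_insert _ _)
  refine ⟨η, h0, ?_, ?_⟩
  · rcases hηS with rfl | hηS
    · exact ⟨0, w₀, by rwa [latticeVec_zero], rfl⟩
    · obtain ⟨k, -, w, hw, rfl⟩ := Set.mem_iUnion₂.1 hηS
      exact ⟨k, w, hw, rfl⟩
  · rintro _ ⟨k, w, hw, rfl⟩
    by_cases hk : k ∈ F
    · exact hη _ (Set.mem_insert_of_mem _ (Set.mem_iUnion₂.2 ⟨k, hk, w, hw, rfl⟩))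
    · exact (h k hk w hw).trans h0

end Micropolar

end

/-- The norm is the operator norm on `ℓ²`, i.e. induced by the Euclidean norm on `ℂ⁸`. -/
theorem mainTheorem7 (p : Micropolar.Params)
    (hμ : 0 < p.μ) (hκ : 0 < p.κ) (hα : 0 < p.α + 4 * p.β / 3) (hγ : 0 < p.β + p.γ)
    (hτ : 0 < p.τ) (hnu : 0 < p.nu) (hlam : p.nu < p.lam) :
    ∃ ηstar : ℝ, 0 < ηstar ∧ IsGreatest p.growthRates ηstar ∧
      (∃ C : ℝ, 0 < C ∧ ∀ (k : Fin 3 → ℤ) (t : ℝ), 0 < t →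
        ‖NormedSpace.exp ((t : ℂ) • p.M (Micropolar.latticeVec k))‖
          ≤ C * (1 + t ^ 8) * Real.exp (ηstar * t)) ∧
      (∀ ε : ℝ, 0 < ε → ∃ C : ℝ, 0 < C ∧ ∀ (k : Fin 3 → ℤ) (t : ℝ), 0 < t →
        ‖NormedSpace.exp ((t : ℂ) • p.symbolB (Micropolar.latticeVec k))‖
          ≤ C * Real.exp ((ηstar + ε) * t)) := by
  have hl : 0 < p.lam := hnu.trans hlam
  have hd : p.d ≠ 0 := (div_pos hτ (by positivity)).ne'
  obtain ⟨w₀, hw₀, hw₀M⟩ := Micropolar.exists_hasEigenvalue_M_zero p hκ hnu hlam hd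
  set m := min p.αt p.γt with hm
  have hm0 : 0 < m := lt_min hα hγ
  -- This threshold is the value of `‖k‖ ^ 2` beyond which the smallness condition of the energy
  -- estimate holds with `η = w₀.re`. Since `r ≥ 0`, the zero wavenumber lies in `F`.
  set r := (p.d * √(p.lam - p.nu)) ^ 2 / (m * w₀.re) with hr
  have hr0 : 0 ≤ r := by positivity
  set F := {k : Fin 3 → ℤ | ‖Micropolar.latticeVec k‖ ^ 2 ≤ r} with hFdef
  have hF : F.Finite := Micropolar.finite_setOf_norm_latticeVec_sq_le r
  have hdiss : ∀ k ∉ F, ∀ v : Micropolar.Idx → ℂ,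
      (star v ⬝ᵥ p.M (Micropolar.latticeVec k) *ᵥ v).re ≤ w₀.re * ∑ i, ‖v i‖ ^ 2 := by
    intro k hk v
    have hk' : r < ‖Micropolar.latticeVec k‖ ^ 2 := not_le.1 hk
    have hk0 : Micropolar.latticeVec k ≠ 0 := by
      rintro h0
      rw [h0, norm_zero] at hk'
      linarith
    rw [Micropolar.M_eq p hl hnu hlam hd]
    refine Matrix.re_star_dotProduct_le_of_real _ _ (fun x => ?_) v
    refine Micropolar.dotProduct_realM_mulVec_le p hμ hκ hl hnu hm0.le (min_le_left _ _)
      (min_le_right _ _) hw₀ _ hk0 ?_ x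
    have := (div_le_iff₀ (by positivity)).1 hk'.le
    linarith
  obtain ⟨η, hη0, hη⟩ := Micropolar.exists_isGreatest_growthRates p w₀ hw₀M F hF
    fun k hk w hw => Matrix.re_le_of_hasEigenvalue _ _ (hdiss k hk) w hw
  have hηpos : 0 < η := hw₀.trans_le hη0
  have hbound : ∃ C : ℝ, 0 < C ∧ ∀ (k : Fin 3 → ℤ) (t : ℝ), 0 < t →
      ‖NormedSpace.exp ((t : ℂ) • p.M (Micropolar.latticeVec k))‖
        ≤ C * (1 + t ^ 8) * Real.exp (η * t) := by
    choose C hC0 hC using fun k : Fin 3 → ℤ => Matrix.exists_norm_exp_smul_le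
      (p.M (Micropolar.latticeVec k)) η fun w hw => hη.2 ⟨k, w, hw, rfl⟩
    have hcard : Fintype.card Micropolar.Idx = 8 := rfl
    rw [hcard] at hC
    have hsum : 0 ≤ ∑ k ∈ hF.toFinset, C k := Finset.sum_nonneg fun k _ => (hC0 k).le
    -- The sum serves the wavenumbers in `F`; the `1` serves all others, where the dissipative bound
    -- has constant `1`.
    refine ⟨1 + ∑ k ∈ hF.toFinset, C k, by positivity, fun k t ht => ?_⟩
    by_cases hk : k ∈ F
    · refine (hC k t ht).trans ?_
      have := Finset.single_le_sum (f := C) (fun k _ => (hC0 k).le) (hF.mem_toFinset.2 hk)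
      gcongr
      linarith
    · refine (Matrix.norm_exp_smul_le _ _ (hdiss k hk) t ht.le).trans ?_
      calc Real.exp (w₀.re * t) ≤ 1 * Real.exp (η * t) := by
            rw [one_mul]
            gcongr
        _ ≤ _ := by
          gcongr
          have : 0 < t ^ 8 := by positivity
          nlinarith
  refine ⟨η, hηpos, hη, hbound, fun ε hε => ?_⟩
  obtain ⟨C, hC, h⟩ := hbound
  obtain ⟨C', hC', h'⟩ := Micropolar.exists_norm_exp_smul_symbolB_le p hnu hlam hd
    (Set.range Micropolar.latticeVec) hC hηpos hε (by rintro _ ⟨k, rfl⟩ t ht; exact h k t ht)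
  exact ⟨C', hC', fun k t ht => h' _ ⟨k, rfl⟩ t ht⟩
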